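/- Let $n\ge 1$. Call $\boldsymbol\alpha=(\alpha_1,\dots,\alpha_m)$ with $\alpha_i\in(0,1)$ a contraction vector if $\sum_{i=1}^m\alpha_i^n<1$, and let $\mathcal D(\boldsymbol\alpha)$ be the collection of all dust-like self-similar sets in $\mathbb R^n$ with contraction vector $\boldsymbol\alpha$, i.e. all nonempty compact sets $E\subset\mathbb R^n$ for which there are maps $f_i(x)=\alpha_iR_i(x+t_i)$, with $R_i$ an orthogonal matrix and $t_i\in\mathbb R^n$ $(1\le i\le m)$, such that $E=\bigcup_{i=1}^m f_i(E)$ and $f_i(E)\cap f_j(E)=\emptyset$ for $i\ne j$. Write $\mathcal D(\boldsymbol\alpha)\sim\mathcal D(\boldsymbol\beta)$ if there are $E\in\mathcal D(\boldsymbol\alpha)$ and $F\in\mathcal D(\boldsymbol\beta)$ that are Lipschitz equivalent, i.e. there are a bijection $\phi:E\to F$ and a constant $C>0$ with $C^{-1}|x-y|\le|\phi(x)-\phi(y)|\le C|x-y|$ for all $x,y\in E$. Let $0<\lambda<1$ and let $a,b,c,d,e$ be positive integers such that $\boldsymbol\alpha=(\lambda^a,\lambda^b,\lambda^c)$ and $\boldsymbol\beta=(\lambda^d,\lambda^e)$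 are contraction vectors. If $\mathcal D(\boldsymbol\alpha)\sim\mathcal D(\boldsymbol\beta)$, then $\max\{a,b,c\}\ge\max\{d,e\}$. -/

import Mathlib

/-- `E ∼ F`: there is a bi-Lipschitz bijection from `E` onto `F`. -/
def LipschitzEquivalent {n : ℕ} (E F : Set (EuclideanSpace ℝ (Fin n))) : Prop :=
  ∃ φ : E → F, Function.Bijective φ ∧
    ∃ C : ℝ, 0 < C ∧
      ∀ x y : E, C⁻¹ * dist x y ≤ dist (φ x) (φ y) ∧ dist (φ x) (φ y) ≤ C * dist x y

/-- `α = (α₁, …, αₘ)` is a contraction vector (in `ℝⁿ`): every `αᵢ` lies in `(0, 1)` and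
`∑ αᵢ ^ n < 1`. -/
def IsContractionVector (n : ℕ) {m : ℕ} (α : Fin m → ℝ) : Prop :=
  (∀ i, 0 < α i ∧ α i < 1) ∧ ∑ i, α i ^ n < 1

/-- The similarity `x ↦ ρ R (x + t)` of `ℝⁿ`, with ratio `ρ`, orthogonal part `R` and
translation `t`. -/
noncomputable def similarityMap {n : ℕ} (ρ : ℝ)
    (R : EuclideanSpace ℝ (Fin n) ≃ₗᵢ[ℝ] EuclideanSpace ℝ (Fin n))
    (t : EuclideanSpace ℝ (Fin n)) (x : EuclideanSpace ℝ (Fin n)) :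
    EuclideanSpace ℝ (Fin n) :=
  ρ • R (x + t)

/-- `𝒟(α)`: the collection of all dust-like self-similar sets in `ℝⁿ` with contraction vector
`α`, that is, all nonempty compact `E` which are the disjoint union of the `fᵢ(E)` for some
similarities `fᵢ` of ratios `αᵢ`. -/
def dustLikeSets (n : ℕ) {m : ℕ} (α : Fin m → ℝ) : Set (Set (EuclideanSpace ℝ (Fin n))) :=
  {E | E.Nonempty ∧ IsCompact E ∧
    ∃ (R : Fin m → (EuclideanSpace ℝ (Fin n) ≃ₗᵢ[ℝ] EuclideanSpace ℝ (Fin n)))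
      (t : Fin m → EuclideanSpace ℝ (Fin n)),
      E = (⋃ i, similarityMap (α i) (R i) (t i) '' E) ∧
      ∀ i j, i ≠ j →
        Disjoint (similarityMap (α i) (R i) (t i) '' E) (similarityMap (α j) (R j) (t j) '' E)}

/-- `𝒟(α) ∼ 𝒟(β)`: some member of `𝒟(α)` is Lipschitz equivalent to some member of `𝒟(β)`. -/
def DustLipschitzEquivalent (n : ℕ) {m k : ℕ} (α : Fin m → ℝ) (β : Fin k → ℝ) : Prop :=
  ∃ E ∈ dustLikeSets n α, ∃ F ∈ dustLikeSets n β, LipschitzEquivalent E F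

/-! Counting `ρ`-separated points shows that the similarity dimension is a bi-Lipschitz invariant of
dust-like sets. With `s` the common dimension, `x = lam ^ s` satisfies both `x ^ a + x ^ b + x ^ c =
1` and `x ^ d + x ^ e = 1`; the rest is algebra.

Let `e < d`, `F = X ^ d + X ^ e - 1`, `P = X ^ a + X ^ b + X ^ c - 1`, and `F = f * q` with `f` the
minimal polynomial of `x`. Ljunggren's lemma forces `q.mirror = ± q`, so `F` divides `P * F.mirror`;
since `F.mirror ≡ X ^ (d - e) + X ^ e` mod `F` and `X` is a unit mod `F`, `F` divides `P * (X ^ k +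
1)` with `k = |d - 2e|`. If `a, b, c < d`, reducing each monomial mod `F` and evaluating at `1`
gives a total of at least `3 - 2 > 0`, a contradiction. -/

/-! ### Packing counts for self-similar sets -/

/-- A self-similar set with ratios `α`: if `∑ α i ^ s = 1`, then it contains at most
`A * ρ ^ (-s)` points with mutual distances at least `ρ`. -/
theorem exists_card_le_of_selfSimilar {X ι : Type*} [MetricSpace X] [Fintype ι] [Nonempty ι]
    {E : Set X} (hE : Bornology.IsBounded E) {f : ι → X → X} {α : ι → ℝ}
    (hα : ∀ i, 0 < α i ∧ α i < 1) (hf : ∀ i x y, dist (f i x) (f i y) = α i * dist x y)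
    (hEf : E ⊆ ⋃ i, f i '' E) {s : ℝ} (hs : 0 < s) (hsum : ∑ i, α i ^ s = 1) :
    ∃ A : ℝ, 0 < A ∧ ∀ ρ : ℝ, 0 < ρ → ρ ≤ 1 → ∀ S : Finset X, (S : Set X) ⊆ E →
      (S : Set X).Pairwise (fun x y => ρ ≤ dist x y) → (S.card : ℝ) ≤ A * ρ ^ (-s) := by
  classical
  obtain ⟨D₀, hD₀⟩ := Metric.isBounded_iff.1 hE
  set D := max D₀ 1
  have hD1 : 1 ≤ D := le_max_right _ _
  have hD : ∀ x ∈ E, ∀ y ∈ E, dist x y ≤ D := fun x hx y hy => (hD₀ hx hy).trans (le_max_left _ _)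
  obtain ⟨i₀, hi₀⟩ := Finite.exists_min α
  obtain ⟨i₁, hi₁⟩ := Finite.exists_max α
  set r := α i₀
  set t := α i₁
  have hr : 0 < r := (hα i₀).1
  have ht : 0 < t := (hα i₁).1
  -- For `ρ ≤ D`, rescaling a piece gives `ρ / α i ≤ D / r`, so the range `ρ ≤ L` is stable under
  -- the induction.
  set L := D / r
  have hL0 : 0 < L := by positivity
  have hL1 : 1 ≤ L := by
    rw [le_div_iff₀ hr]
    linarith [(hα i₀).2]
  have key : ∀ k : ℕ, ∀ ρ : ℝ, D * t ^ k < ρ → ρ ≤ L → ∀ S : Finset X, (S : Set X) ⊆ E →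
      (S : Set X).Pairwise (fun x y => ρ ≤ dist x y) → (S.card : ℝ) ≤ L ^ s * ρ ^ (-s) := by
    have base : ∀ ρ : ℝ, D < ρ → ρ ≤ L → ∀ S : Finset X, (S : Set X) ⊆ E →
        (S : Set X).Pairwise (fun x y => ρ ≤ dist x y) →
        (S.card : ℝ) ≤ L ^ s * ρ ^ (-s) := by
      intro ρ hDρ hρL S hSE hS
      have hρ : 0 < ρ := by linarith
      have h1 : S.card ≤ 1 := by
        rw [Finset.card_le_one]
        intro x hx y hy
        by_contra hxy
        have h2 := hS hx hy hxy
        linarith [hD x (hSE hx) y (hSE hy)]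
      have h2 : (1 : ℝ) ≤ L ^ s * ρ ^ (-s) := by
        rw [Real.rpow_neg hρ.le, ← div_eq_mul_inv, one_le_div (by positivity)]
        exact Real.rpow_le_rpow hρ.le hρL hs.le
      exact le_trans (by exact_mod_cast h1) h2
    intro k
    induction k with
    | zero => intro ρ h; exact base ρ (by simpa using h)
    | succ k ih =>
      intro ρ hkρ hρL S hSE hS
      rcases lt_or_ge D ρ with hDρ | hDρ
      · exact base ρ hDρ hρL S hSE hS
      have hρ : 0 < ρ := lt_of_le_of_lt (by positivity) hkρ
      have hT : ∀ i, ((S.filter (· ∈ f i '' E)).card : ℝ) ≤ L ^ s * ρ ^ (-s) * α i ^ s := by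
        intro i
        have hi := (hα i).1
        obtain ⟨T, hTE, hTS⟩ := Finset.subset_set_image_iff.1
          (show ((S.filter (· ∈ f i '' E) : Finset X) : Set X) ⊆ f i '' E by
            intro x hx; exact (Finset.mem_filter.1 hx).2)
        have hsep : (T : Set X).Pairwise (fun x y => ρ / α i ≤ dist x y) := by
          intro x hx y hy hxy
          have hmem : ∀ z ∈ T, f i z ∈ S := fun z hz =>
            (Finset.mem_filter.1 (hTS ▸ Finset.mem_image_of_mem (f i) hz)).1
          have hne : f i x ≠ f i y := by
            rw [← dist_pos, hf]
            exact mul_pos hi (dist_pos.2 hxy)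
          have h : ρ ≤ dist (f i x) (f i y) := hS (hmem x hx) (hmem y hy) hne
          rwa [hf, ← div_le_iff₀' hi] at h
        have h1 : D * t ^ k < ρ / α i := by
          rw [lt_div_iff₀ hi]
          refine lt_of_le_of_lt ?_ hkρ
          rw [pow_succ, ← mul_assoc]
          exact mul_le_mul_of_nonneg_left (hi₁ i) (by positivity)
        have h2 : ρ / α i ≤ L := div_le_div₀ (by positivity) hDρ hr (hi₀ i)
        have h3 := ih (ρ / α i) h1 h2 T hTE hsep
        rw [Real.div_rpow hρ.le hi.le, Real.rpow_neg hi.le, div_inv_eq_mul, ← mul_assoc] at h3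
        refine le_trans ?_ h3
        rw [← hTS]
        exact_mod_cast Finset.card_image_le
      have hcov : S ⊆ Finset.univ.biUnion (fun i => S.filter (· ∈ f i '' E)) := by
        intro x hx
        obtain ⟨i, hi⟩ := Set.mem_iUnion.1 (hEf (hSE hx))
        exact Finset.mem_biUnion.2 ⟨i, Finset.mem_univ _, Finset.mem_filter.2 ⟨hx, hi⟩⟩
      calc (S.card : ℝ) ≤ ∑ i, ((S.filter (· ∈ f i '' E)).card : ℝ) := by
            exact_mod_cast (Finset.card_le_card hcov).trans Finset.card_biUnion_le
        _ ≤ ∑ i, L ^ s * ρ ^ (-s) * α i ^ s := Finset.sum_le_sum fun i _ => hT i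
        _ = L ^ s * ρ ^ (-s) := by rw [← Finset.mul_sum, hsum, mul_one]
  refine ⟨L ^ s, by positivity, fun ρ hρ hρ1 S hSE hS => ?_⟩
  obtain ⟨k, hk⟩ := exists_pow_lt_of_lt_one (show 0 < ρ / D by positivity) (hα i₁).2
  exact key k ρ (by rwa [lt_div_iff₀' (by positivity)] at hk) (hρ1.trans hL1) S hSE hS

/-- A dust-like self-similar set with ratios `α`: if `∑ α i ^ s = 1`, then it contains at least
`B * ρ ^ (-s)` points with mutual distances at least `ρ`. -/
theorem exists_le_card_of_dustLike {X ι : Type*} [MetricSpace X] [Fintype ι] [Nonempty ι]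
    {E : Set X} (hE : E.Nonempty) (hEc : IsCompact E) {f : ι → X → X} {α : ι → ℝ}
    (hα : ∀ i, 0 < α i ∧ α i < 1) (hf : ∀ i x y, dist (f i x) (f i y) = α i * dist x y)
    (hEf : (⋃ i, f i '' E) ⊆ E) (hdisj : ∀ i j, i ≠ j → Disjoint (f i '' E) (f j '' E))
    {s : ℝ} (hs : 0 < s) (hsum : ∑ i, α i ^ s = 1) :
    ∃ B : ℝ, 0 < B ∧ ∀ ρ : ℝ, 0 < ρ → ∃ S : Finset X, (S : Set X) ⊆ E ∧
      (S : Set X).Pairwise (fun x y => ρ ≤ dist x y) ∧ B * ρ ^ (-s) ≤ (S.card : ℝ) := by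
  classical
  have hfc : ∀ i, IsCompact (f i '' E) := fun i => hEc.image
    (LipschitzWith.of_dist_le_mul (K := ⟨α i, (hα i).1.le⟩) fun x y => (hf i x y).le).continuous
  have hinj : ∀ i, Function.Injective (f i) := by
    intro i x y hxy
    have h := hf i x y
    rw [hxy, dist_self] at h
    rcases mul_eq_zero.1 h.symm with h | h
    · exact absurd h (hα i).1.ne'
    · exact dist_eq_zero.1 h
  have hδ' : ∀ p : ι × ι, ∃ δ : ℝ, 0 < δ ∧ (p.1 ≠ p.2 →
      ∀ x ∈ f p.1 '' E, ∀ y ∈ f p.2 '' E, δ ≤ dist x y) := by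
    rintro ⟨i, j⟩
    by_cases hij : i = j
    -- Arbitrary value on the diagonal: the minimum `δ` need only bound the gaps from below.
    · exact ⟨1, one_pos, fun h => (h hij).elim⟩
    obtain ⟨r, hr, h⟩ := Metric.exists_pos_forall_lt_edist (hfc i) (hfc j).isClosed
      (hdisj i j hij)
    refine ⟨r, hr, fun _ x hx y hy => ?_⟩
    have := h x hx y hy
    rw [edist_nndist] at this
    exact_mod_cast this.le
  choose δ' hδ'0 hδ' using hδ'
  obtain ⟨p, hp⟩ := Finite.exists_min δ'
  set δ := δ' p
  have hδ0 : 0 < δ := hδ'0 p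
  have hδ : ∀ i j, i ≠ j → ∀ x ∈ f i '' E, ∀ y ∈ f j '' E, δ ≤ dist x y :=
    fun i j hij x hx y hy => (hp (i, j)).trans (hδ' (i, j) hij x hx y hy)
  obtain ⟨i₁, hi₁⟩ := Finite.exists_max α
  set t := α i₁
  have ht : 0 < t := (hα i₁).1
  have key : ∀ k : ℕ, ∀ ρ : ℝ, 0 < ρ → δ * t ^ k ≤ ρ → ∃ S : Finset X, (S : Set X) ⊆ E ∧
      (S : Set X).Pairwise (fun x y => ρ ≤ dist x y) ∧ δ ^ s * ρ ^ (-s) ≤ (S.card : ℝ) := by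
    have base : ∀ ρ : ℝ, δ ≤ ρ → ∃ S : Finset X, (S : Set X) ⊆ E ∧
        (S : Set X).Pairwise (fun x y => ρ ≤ dist x y) ∧
        δ ^ s * ρ ^ (-s) ≤ (S.card : ℝ) := by
      intro ρ hδρ
      have hρ : 0 < ρ := by linarith
      obtain ⟨x, hx⟩ := hE
      refine ⟨{x}, by simpa using hx, by simp, ?_⟩
      rw [Real.rpow_neg hρ.le, ← div_eq_mul_inv, Finset.card_singleton, Nat.cast_one,
        div_le_one (by positivity)]
      exact Real.rpow_le_rpow hδ0.le hδρ hs.le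
    intro k
    induction k with
    | zero => intro ρ _ h; exact base ρ (by simpa using h)
    | succ k ih =>
      intro ρ hρ hkρ
      rcases le_or_gt δ ρ with hδρ | hδρ
      · exact base ρ hδρ
      have hT : ∀ i, ∃ T : Finset X, (T : Set X) ⊆ E ∧
          (T : Set X).Pairwise (fun x y => ρ / α i ≤ dist x y) ∧
          δ ^ s * (ρ / α i) ^ (-s) ≤ (T.card : ℝ) := by
        intro i
        have hi := (hα i).1
        refine ih (ρ / α i) (by positivity) ?_
        rw [le_div_iff₀ hi]
        refine le_trans ?_ hkρ
        rw [pow_succ, ← mul_assoc]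
        exact mul_le_mul_of_nonneg_left (hi₁ i) (by positivity)
      choose T hTE hTsep hTcard using hT
      have hmem : ∀ i, ∀ x ∈ (T i).image (f i), x ∈ f i '' E := by
        intro i x hx
        obtain ⟨z, hz, rfl⟩ := Finset.mem_image.1 hx
        exact ⟨z, hTE i hz, rfl⟩
      refine ⟨Finset.univ.biUnion fun i => (T i).image (f i), ?_, ?_, ?_⟩
      · intro x hx
        obtain ⟨i, -, hi⟩ := Finset.mem_biUnion.1 hx
        exact hEf (Set.mem_iUnion.2 ⟨i, hmem i x hi⟩)
      · intro x hx y hy hxy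
        obtain ⟨i, -, hi⟩ := Finset.mem_biUnion.1 hx
        obtain ⟨j, -, hj⟩ := Finset.mem_biUnion.1 hy
        by_cases hij : i = j
        · subst hij
          obtain ⟨z, hz, rfl⟩ := Finset.mem_image.1 hi
          obtain ⟨w, hw, rfl⟩ := Finset.mem_image.1 hj
          have h : ρ / α i ≤ dist z w := hTsep i hz hw (fun h => hxy (by rw [h]))
          rwa [hf, ← div_le_iff₀' (hα i).1]
        · exact hδρ.le.trans (hδ i j hij x (hmem i x hi) y (hmem j y hj))
      · rw [Finset.card_biUnion]
        · push_cast
          calc δ ^ s * ρ ^ (-s) = ∑ i, δ ^ s * ρ ^ (-s) * α i ^ s := by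
                rw [← Finset.mul_sum, hsum, mul_one]
            _ ≤ _ := by
                refine Finset.sum_le_sum fun i _ => ?_
                have h3 := hTcard i
                have hi := (hα i).1
                rw [Real.div_rpow hρ.le hi.le, Real.rpow_neg hi.le, div_inv_eq_mul,
                  ← mul_assoc] at h3
                rwa [Finset.card_image_of_injective _ (hinj i)]
        · intro i _ j _ hij
          refine Finset.disjoint_left.2 fun x hx hx' => ?_
          exact Set.disjoint_left.1 (hdisj i j hij) (hmem i x hx) (hmem j x hx')
  refine ⟨δ ^ s, by positivity, fun ρ hρ => ?_⟩
  obtain ⟨k, hk⟩ := exists_pow_lt_of_lt_one (show 0 < ρ / δ by positivity) (hα i₁).2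
  refine key k ρ hρ ?_
  rw [lt_div_iff₀' hδ0] at hk
  exact hk.le

/-! ### Bi-Lipschitz invariance of the similarity dimension -/

theorem le_of_forall_rpow_neg_le {s s' A B : ℝ} (hB : 0 < B)
    (h : ∀ ρ : ℝ, 0 < ρ → ρ ≤ 1 → B * ρ ^ (-s) ≤ A * ρ ^ (-s')) : s ≤ s' := by
  by_contra! hlt
  have hlim : Filter.Tendsto (fun u : ℝ => u ^ (s - s')) Filter.atTop Filter.atTop :=
    tendsto_rpow_atTop (by linarith)
  obtain ⟨u, hu, hu1⟩ :=
    ((hlim.eventually_gt_atTop (A / B)).and (Filter.eventually_ge_atTop 1)).exists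
  have hu0 : 0 < u := by linarith
  have h1 := h u⁻¹ (by positivity) (inv_le_one_of_one_le₀ hu1)
  rw [Real.rpow_neg_eq_inv_rpow, Real.rpow_neg_eq_inv_rpow, inv_inv] at h1
  rw [Real.rpow_sub hu0, div_lt_div_iff₀ hB (by positivity)] at hu
  linarith

theorem LipschitzEquivalent.symm {n : ℕ} {E F : Set (EuclideanSpace ℝ (Fin n))}
    (h : LipschitzEquivalent E F) : LipschitzEquivalent F E := by
  obtain ⟨φ, hφ, C, hC, h⟩ := h
  set e := Equiv.ofBijective φ hφ
  refine ⟨e.symm, e.symm.bijective, C, hC, fun x y => ?_⟩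
  have h1 := h (e.symm x) (e.symm y)
  have hx : ∀ z, φ (e.symm z) = z := e.apply_symm_apply
  rw [hx, hx] at h1
  constructor
  · rw [inv_mul_le_iff₀ hC]; exact h1.2
  · rw [← inv_mul_le_iff₀ hC]; exact h1.1

theorem dist_similarityMap {n : ℕ} {ρ : ℝ} (hρ : 0 < ρ)
    (R : EuclideanSpace ℝ (Fin n) ≃ₗᵢ[ℝ] EuclideanSpace ℝ (Fin n))
    (t x y : EuclideanSpace ℝ (Fin n)) :
    dist (similarityMap ρ R t x) (similarityMap ρ R t y) = ρ * dist x y := by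
  simp [similarityMap, dist_smul₀, abs_of_pos hρ]

/-- The similarity dimension is monotone under bi-Lipschitz maps of dust-like sets. -/
theorem LipschitzEquivalent.similarityDimension_le {n m k : ℕ} [NeZero m] [NeZero k]
    {α : Fin m → ℝ} {β : Fin k → ℝ} (hα : ∀ i, 0 < α i ∧ α i < 1) (hβ : ∀ i, 0 < β i ∧ β i < 1)
    {E F : Set (EuclideanSpace ℝ (Fin n))} (hE : E ∈ dustLikeSets n α)
    (hF : F ∈ dustLikeSets n β) (h : LipschitzEquivalent E F) {s s' : ℝ} (hs : 0 < s)
    (hs' : 0 < s') (hsum : ∑ i, α i ^ s = 1) (hsum' : ∑ i, β i ^ s' = 1) : s ≤ s' := by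
  classical
  obtain ⟨hEne, hEc, R, t, hEf, hEd⟩ := hE
  obtain ⟨-, hFc, R', t', hFf, -⟩ := hF
  obtain ⟨φ, hφ, C, hC, hφC⟩ := h
  obtain ⟨B, hB, hlow⟩ := exists_le_card_of_dustLike hEne hEc hα
    (fun i => dist_similarityMap (hα i).1 (R i) (t i)) hEf.ge hEd hs hsum
  obtain ⟨A, hA, hupp⟩ := exists_card_le_of_selfSimilar hFc.isBounded hβ
    (fun i => dist_similarityMap (hβ i).1 (R' i) (t' i)) hFf.le hs' hsum'
  refine le_of_forall_rpow_neg_le (A := A) (B := B * C ^ (-s)) (by positivity)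
    fun ρ hρ hρ1 => ?_
  -- `φ` shrinks distances by at most the factor `C`, so the image of `S` is `ρ`-separated.
  obtain ⟨S, hSE, hSsep, hScard⟩ := hlow (C * ρ) (by positivity)
  lift S to Finset E using hSE
  have hinj : Function.Injective (fun x : E => (φ x : EuclideanSpace ℝ (Fin n))) :=
    Subtype.val_injective.comp hφ.injective
  have h1 := hupp ρ hρ hρ1 (S.image fun x => (φ x : EuclideanSpace ℝ (Fin n))) ?_ ?_
  · rw [Finset.card_image_of_injective _ hinj] at h1
    rw [Finset.card_image_of_injective _ Subtype.val_injective, Real.mul_rpow hC.le hρ.le, ← mul_assoc] at hScard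
    exact hScard.trans h1
  · intro y hy
    obtain ⟨x, -, rfl⟩ := Finset.mem_image.1 hy
    exact (φ x).2
  · intro y hy z hz hyz
    obtain ⟨x, hx, rfl⟩ := Finset.mem_image.1 hy
    obtain ⟨w, hw, rfl⟩ := Finset.mem_image.1 hz
    have hxw : (x : EuclideanSpace ℝ (Fin n)) ≠ w := by
      rintro h
      exact hyz (by rw [Subtype.ext h])
    have h2 : C * ρ ≤ dist x w := hSsep (by simpa using hx) (by simpa using hw) hxw
    refine le_trans ?_ (hφC x w).1
    rwa [le_inv_mul_iff₀ hC]

/-! ### Common root of the Moran equations -/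

/-- A finite sum of at least two positive powers of `x` equals `1` for some `x ∈ (0, 1)`. -/
theorem exists_sum_pow_eq_one {m : ℕ} (hm : 2 ≤ m) {p : Fin m → ℕ} (hp : ∀ i, 0 < p i) :
    ∃ x : ℝ, 0 < x ∧ x < 1 ∧ ∑ i, x ^ p i = 1 := by
  have hcont : ContinuousOn (fun x : ℝ => ∑ i, x ^ p i) (Set.Icc 0 1) := by fun_prop
  have h0 : ∑ i, (0 : ℝ) ^ p i = 0 := Finset.sum_eq_zero fun i _ => zero_pow (hp i).ne'
  have h1 : ∑ i, (1 : ℝ) ^ p i = m := by simp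
  have hm' : (1 : ℝ) < m := by exact_mod_cast hm
  obtain ⟨x, hx, hx1⟩ := intermediate_value_Ioo zero_le_one hcont
    (show (1 : ℝ) ∈ Set.Ioo _ _ by simp only [h0, h1]; exact ⟨one_pos, hm'⟩)
  exact ⟨x, hx.1, hx.2, hx1⟩

/-- If dust-like sets whose ratios are powers of `lam` are Lipschitz equivalent, then the
exponents satisfy Moran equations with a common root. -/
theorem DustLipschitzEquivalent.exists_common_root {n m k : ℕ} (hm : 2 ≤ m) (hk : 2 ≤ k)
    {lam : ℝ} (hlam0 : 0 < lam) (hlam1 : lam < 1) {p : Fin m → ℕ} {q : Fin k → ℕ}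
    (hp : ∀ i, 0 < p i) (hq : ∀ i, 0 < q i)
    (h : DustLipschitzEquivalent n (fun i => lam ^ p i) (fun i => lam ^ q i)) :
    ∃ x : ℝ, 0 < x ∧ x < 1 ∧ ∑ i, x ^ p i = 1 ∧ ∑ i, x ^ q i = 1 := by
  obtain ⟨E, hE, F, hF, hEF⟩ := h
  obtain ⟨x, hx0, hx1, hx⟩ := exists_sum_pow_eq_one hm hp
  obtain ⟨y, hy0, hy1, hy⟩ := exists_sum_pow_eq_one hk hq
  have : NeZero m := ⟨by omega⟩
  have : NeZero k := ⟨by omega⟩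
  have hpos : ∀ z : ℝ, 0 < z → z < 1 → 0 < Real.logb lam z := fun z hz0 hz1 =>
    Real.logb_pos_of_base_lt_one hlam0 hlam1 hz0 hz1
  have hpow : ∀ z : ℝ, 0 < z → ∀ j : ℕ, (lam ^ j) ^ Real.logb lam z = z ^ j := by
    intro z hz j
    rw [← Real.rpow_natCast lam j, ← Real.rpow_mul hlam0.le, mul_comm, Real.rpow_mul hlam0.le,
      Real.rpow_logb hlam0 hlam1.ne hz, Real.rpow_natCast]
  have hratio : ∀ j : ℕ, 0 < j → 0 < lam ^ j ∧ lam ^ j < 1 := fun j hj =>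
    ⟨by positivity, pow_lt_one₀ hlam0.le hlam1 hj.ne'⟩
  have hsx : ∑ i, (lam ^ p i) ^ Real.logb lam x = 1 := by simp only [hpow x hx0, hx]
  have hsy : ∑ i, (lam ^ q i) ^ Real.logb lam y = 1 := by simp only [hpow y hy0, hy]
  have hxy : Real.logb lam x = Real.logb lam y := le_antisymm
    (hEF.similarityDimension_le (fun i => hratio _ (hp i)) (fun i => hratio _ (hq i)) hE hF
      (hpos x hx0 hx1) (hpos y hy0 hy1) hsx hsy)
    (hEF.symm.similarityDimension_le (fun i => hratio _ (hq i)) (fun i => hratio _ (hp i)) hF hE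
      (hpos y hy0 hy1) (hpos x hx0 hx1) hsy hsx)
  have hxy' : x = y := by
    rw [← Real.rpow_logb hlam0 hlam1.ne hx0, hxy, Real.rpow_logb hlam0 hlam1.ne hy0]
  exact ⟨x, hx0, hx1, hx, hxy' ▸ hy⟩

/-! ### Ljunggren's lemma and the self-reciprocal cofactor -/

open Polynomial in
/-- Ljunggren's lemma: a unit trinomial is determined, up to sign and mirror image, by its product
with its mirror image. -/
theorem Polynomial.IsUnitTrinomial.eq_or_mirror_of_mul_mirror_eq {p q : ℤ[X]}
    (hp : p.IsUnitTrinomial) (hpq : p * p.mirror = q * q.mirror) :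
    q = p ∨ q = -p ∨ q = p.mirror ∨ q = -p.mirror := by
  have hq : IsUnitTrinomial q := (isUnitTrinomial_iff'' hpq).mp hp
  obtain ⟨k, m, n, hkm, hmn, u, v, w, hp⟩ := hp
  obtain ⟨k', m', n', hkm', hmn', x, y, z, hq⟩ := hq
  have hk : k = k' := by
    rw [← mul_right_inj' (show 2 ≠ 0 from two_ne_zero), ←
      trinomial_natTrailingDegree hkm hmn u.ne_zero, ← hp, ← natTrailingDegree_mul_mirror, hpq,
      natTrailingDegree_mul_mirror, hq, trinomial_natTrailingDegree hkm' hmn' x.ne_zero]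
  have hn : n = n' := by
    rw [← mul_right_inj' (show 2 ≠ 0 from two_ne_zero), ← trinomial_natDegree hkm hmn w.ne_zero, ←
      hp, ← natDegree_mul_mirror, hpq, natDegree_mul_mirror, hq,
      trinomial_natDegree hkm' hmn' z.ne_zero]
  subst hk
  subst hn
  -- `irreducible_aux3` needs equal middle coefficients; these are `±1`, so replacing `p` by `-p`
  -- suffices.
  rcases eq_or_eq_neg_of_sq_eq_sq (y : ℤ) (v : ℤ)
      ((Int.isUnit_sq y.isUnit).trans (Int.isUnit_sq v.isUnit).symm) with
    (h1 | h1)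
  · rw [h1] at hq
    rcases IsUnitTrinomial.irreducible_aux3 hkm hmn hkm' hmn' u v w x z hp hq hpq with (h2 | h2)
    · exact Or.inl h2
    · exact Or.inr (Or.inr (Or.inl h2))
  · rw [h1] at hq
    rw [trinomial_def] at hp
    rw [← neg_inj, neg_add, neg_add, ← neg_mul, ← neg_mul, ← neg_mul, ← C_neg, ← C_neg, ← C_neg]
      at hp
    rw [← neg_mul_neg, ← mirror_neg] at hpq
    rcases IsUnitTrinomial.irreducible_aux3 hkm hmn hkm' hmn' (-u) (-v) (-w) x z hp hq hpq with
      (rfl | rfl)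
    · exact Or.inr (Or.inl rfl)
    · exact Or.inr (Or.inr (Or.inr p.mirror_neg))

open Polynomial in
theorem trinomial_eq_X_pow_add_X_pow_sub_one (d e : ℕ) :
    trinomial 0 e d (-1 : ℤ) 1 1 = X ^ d + X ^ e - 1 := by
  simp [trinomial_def]; ring

open Polynomial in
theorem mirror_X_pow_add_X_pow_sub_one {d e : ℕ} (he : 0 < e) (hed : e < d) :
    (X ^ d + X ^ e - 1 : ℤ[X]).mirror = 1 + X ^ (d - e) - X ^ d := by
  rw [← trinomial_eq_X_pow_add_X_pow_sub_one,
    trinomial_mirror he hed (by norm_num) (by norm_num)]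
  simp [trinomial_def]; ring

open Polynomial in
theorem monic_X_pow_add_X_pow_sub_one {d e : ℕ} (he : 0 < e) (hed : e < d) :
    (X ^ d + X ^ e - 1 : ℤ[X]).Monic := by
  rw [← trinomial_eq_X_pow_add_X_pow_sub_one]
  exact trinomial_monic he hed

open Polynomial in
/-- The cofactor of the minimal polynomial of `x ∈ (0, 1)` in `X ^ d + X ^ e - 1` is
self-reciprocal, so that any integer polynomial vanishing at `x` becomes a multiple of
`X ^ d + X ^ e - 1` after multiplication by `X ^ (d - e) + X ^ e`. -/
theorem X_pow_add_X_pow_sub_one_dvd_mul {d e : ℕ} (he : 0 < e) (hed : e < d) {x : ℝ}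
    (hx0 : 0 < x) (hx1 : x < 1) (hx : x ^ d + x ^ e = 1) {P : ℤ[X]} (hP : aeval x P = 0) :
    (X ^ d + X ^ e - 1 : ℤ[X]) ∣ P * (X ^ (d - e) + X ^ e) := by
  set F : ℤ[X] := X ^ d + X ^ e - 1 with hF
  have hFm : F.Monic := monic_X_pow_add_X_pow_sub_one he hed
  have hFx : aeval x F = 0 := by simp [hF, hx]
  have hFt : F.IsUnitTrinomial := by
    refine ⟨0, e, d, he, hed, -1, 1, 1, ?_⟩
    rw [hF, ← trinomial_eq_X_pow_add_X_pow_sub_one]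
    simp
  have hint : IsIntegral ℤ x := ⟨F, hFm, by simpa [aeval_def] using hFx⟩
  obtain ⟨q, hq⟩ := minpoly.isIntegrallyClosed_dvd hint hFx
  obtain ⟨r, hr⟩ := minpoly.isIntegrallyClosed_dvd hint hP
  set f := minpoly ℤ x with hf
  have hfx : aeval x f = 0 := minpoly.aeval ℤ x
  have hf0 : f ≠ 0 := minpoly.ne_zero hint
  have hq0 : q ≠ 0 := by
    rintro rfl
    exact hFm.ne_zero (by simpa using hq)
  have hFmir : F.mirror = f.mirror * q.mirror := by rw [hq, mirror_mul_of_domain]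
  have hmir : F.mirror = X ^ (d - e) + X ^ e - F := by
    rw [hF, mirror_X_pow_add_X_pow_sub_one he hed]; ring
  have hprod : F * F.mirror = (f * q.mirror) * (f * q.mirror).mirror := by
    rw [hFmir, hq, mirror_mul_of_domain, mirror_mirror]; ring
  -- Otherwise `x` would be a root of `F.mirror`, whose value at `x` is `1 + x ^ (d - e) - x ^ d >
  -- 0`.
  have hnot : ∀ s : ℤ[X], f.mirror = s * f → False := by
    intro s hs
    have h1 : aeval x F.mirror = 0 := by
      rw [hFmir, hs]; simp [hfx]
    rw [hF, mirror_X_pow_add_X_pow_sub_one he hed] at h1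
    simp only [map_sub, map_add, map_one, map_pow, aeval_X] at h1
    have : x ^ d < 1 := pow_lt_one₀ hx0.le hx1 (by omega)
    have : 0 < x ^ (d - e) := by positivity
    linarith
  have key : ∃ s : ℤ[X], q.mirror = s * q := by
    have hqm : q.mirror ≠ 0 := by simpa using hq0
    rcases hFt.eq_or_mirror_of_mul_mirror_eq hprod with h | h | h | h
    · exact ⟨1, mul_left_cancel₀ hf0 (by rw [h, hq]; ring)⟩
    · exact ⟨-1, mul_left_cancel₀ hf0 (by rw [h, hq]; ring)⟩
    · exact (hnot 1 (mul_right_cancel₀ hqm (by rw [← hFmir, ← h]; ring))).elim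
    · exact (hnot (-1) (mul_right_cancel₀ hqm
        (by rw [← hFmir, ← neg_neg F.mirror, ← h]; ring))).elim
  obtain ⟨s, hs⟩ := key
  have h1 : P * (X ^ (d - e) + X ^ e) = P * F.mirror + P * F := by rw [hmir]; ring
  rw [h1]
  refine dvd_add ⟨r * s * f.mirror, ?_⟩ (dvd_mul_left _ _)
  rw [hFmir, hs, hq, hr]; ring

/-! ### Remainders modulo the trinomial, evaluated at `1` -/

open Polynomial in
theorem eval_one_X_pow_modByMonic_of_lt {d e : ℕ} (he : 0 < e) (hed : e < d) {n : ℕ}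
    (hn : n < d) : (X ^ n %ₘ (X ^ d + X ^ e - 1 : ℤ[X])).eval 1 = 1 := by
  rw [(modByMonic_eq_self_iff (monic_X_pow_add_X_pow_sub_one he hed)).2]
  · simp
  · rw [degree_X_pow, ← trinomial_eq_X_pow_add_X_pow_sub_one,
      degree_eq_natDegree (trinomial_monic he hed).ne_zero,
      trinomial_natDegree he hed one_ne_zero]
    exact_mod_cast hn

-- For `d ≤ n < 2 * d`, `X ^ n ≡ X ^ (n - d) - X ^ (n - d + e)` and the first term is already
-- reduced, so the value is `1 - v` with `v` the value at the smaller exponent `n - d + e`; `v ↦ 1 -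
-- v` preserves `[0, 1]`.
open Polynomial in
theorem eval_one_X_pow_modByMonic_mem_Icc {d e : ℕ} (he : 0 < e) (hed : e < d) {n : ℕ}
    (hn : n < 2 * d) : (X ^ n %ₘ (X ^ d + X ^ e - 1 : ℤ[X])).eval 1 ∈ Set.Icc (0 : ℤ) 1 := by
  induction n using Nat.strong_induction_on with
  | _ n ih =>
    rcases lt_or_ge n d with h | h
    · rw [eval_one_X_pow_modByMonic_of_lt he hed h]; simp
    · set F : ℤ[X] := X ^ d + X ^ e - 1 with hF
      have h1 : (X ^ n : ℤ[X]) = X ^ (n - d) * F + X ^ (n - d) - X ^ (n - d + e) := by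
        obtain ⟨k, rfl⟩ := Nat.exists_eq_add_of_le h
        rw [hF, Nat.add_sub_cancel_left]; ring
      have h2 : (X ^ n %ₘ F).eval 1 = 1 - (X ^ (n - d + e) %ₘ F).eval 1 := by
        have h3 : (X ^ (n - d) * F) %ₘ F = 0 := by
          rw [modByMonic_eq_zero_iff_dvd (monic_X_pow_add_X_pow_sub_one he hed)]
          exact dvd_mul_left _ _
        rw [h1, sub_modByMonic, add_modByMonic, h3, zero_add, eval_sub,
          eval_one_X_pow_modByMonic_of_lt he hed (by omega)]
      have h3 := ih (n - d + e) (by omega) (by omega)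
      rw [h2]
      simp only [Set.mem_Icc] at h3 ⊢
      omega

-- `X * (X ^ (d - 1) + X ^ (e - 1)) = F + 1` makes `X` invertible mod `F`.
open Polynomial in
theorem isCoprime_X_pow_X_pow_add_X_pow_sub_one {d e : ℕ} (he : 0 < e) (hed : e < d) (m : ℕ) :
    IsCoprime (X ^ d + X ^ e - 1 : ℤ[X]) (X ^ m) := by
  refine IsCoprime.pow_right ⟨-1, X ^ (d - 1) + X ^ (e - 1), ?_⟩
  obtain ⟨d, rfl⟩ := Nat.exists_eq_succ_of_ne_zero (show d ≠ 0 by omega)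
  obtain ⟨e, rfl⟩ := Nat.exists_eq_succ_of_ne_zero (show e ≠ 0 by omega)
  simp only [Nat.succ_eq_add_one, Nat.add_sub_cancel]
  ring

open Polynomial in
theorem le_max_of_pow_add_pow_eq_one_of_lt {x : ℝ} (hx0 : 0 < x) (hx1 : x < 1)
    {a b c d e : ℕ} (he : 0 < e) (hed : e < d)
    (hx : x ^ d + x ^ e = 1) (hx' : x ^ a + x ^ b + x ^ c = 1) : d ≤ max a (max b c) := by
  by_contra! hlt
  have hP : aeval x (X ^ a + X ^ b + X ^ c - 1 : ℤ[X]) = 0 := by simp [hx']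
  have h := X_pow_add_X_pow_sub_one_dvd_mul he hed hx0 hx1 hx hP
  -- Here `m = min e (d - e)` and `k = |d - 2e|`; `k < d` keeps `a + k`, `b + k`, `c + k` below `2 *
  -- d`.
  obtain ⟨m, k, hk, hmk⟩ : ∃ m k : ℕ, k < d ∧
      (X ^ (d - e) + X ^ e : ℤ[X]) = X ^ m * (X ^ k + 1) := by
    rcases le_total e (d - e) with h1 | h1
    · refine ⟨e, d - e - e, by omega, ?_⟩
      rw [mul_add, ← pow_add, Nat.add_sub_cancel' h1, mul_one]
    · refine ⟨d - e, e - (d - e), by omega, ?_⟩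
      rw [mul_add, ← pow_add, Nat.add_sub_cancel' h1, mul_one, add_comm]
  rw [hmk, mul_left_comm] at h
  replace h := (isCoprime_X_pow_X_pow_add_X_pow_sub_one he hed m).dvd_of_dvd_mul_left h
  rw [← modByMonic_eq_zero_iff_dvd (monic_X_pow_add_X_pow_sub_one he hed)] at h
  have h2 : (X ^ a + X ^ b + X ^ c - 1 : ℤ[X]) * (X ^ k + 1) =
      X ^ (a + k) + X ^ (b + k) + X ^ (c + k) + X ^ a + X ^ b + X ^ c - X ^ k - X ^ 0 := by
    ring
  have h3 := congrArg (eval 1) h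
  simp only [h2, sub_modByMonic, add_modByMonic, eval_sub, eval_add, eval_zero] at h3
  simp only [max_lt_iff] at hlt
  rw [eval_one_X_pow_modByMonic_of_lt he hed hlt.1,
    eval_one_X_pow_modByMonic_of_lt he hed hlt.2.1,
    eval_one_X_pow_modByMonic_of_lt he hed hlt.2.2,
    eval_one_X_pow_modByMonic_of_lt he hed hk,
    eval_one_X_pow_modByMonic_of_lt he hed (n := 0) (by omega)] at h3
  have ha := (eval_one_X_pow_modByMonic_mem_Icc he hed (n := a + k) (by omega)).1
  have hb := (eval_one_X_pow_modByMonic_mem_Icc he hed (n := b + k) (by omega)).1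
  have hc := (eval_one_X_pow_modByMonic_mem_Icc he hed (n := c + k) (by omega)).1
  omega

theorem max_le_max_of_pow_add_pow_eq_one {x : ℝ} (hx0 : 0 < x) (hx1 : x < 1)
    {a b c d e : ℕ} (hd : 0 < d) (he : 0 < e)
    (hx : x ^ d + x ^ e = 1) (hx' : x ^ a + x ^ b + x ^ c = 1) :
    max d e ≤ max a (max b c) := by
  rcases lt_trichotomy d e with h | rfl | h
  · rw [max_eq_right h.le]
    exact le_max_of_pow_add_pow_eq_one_of_lt hx0 hx1 hd h (by rw [add_comm, hx]) hx'
  · rw [max_self]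
    -- Here `x ^ d = 1 / 2`, so `a, b < d` already gives `x ^ a + x ^ b > 1`.
    by_contra! hlt
    simp only [max_lt_iff] at hlt
    have ha := pow_lt_pow_right_of_lt_one₀ hx0 hx1 hlt.1
    have hb := pow_lt_pow_right_of_lt_one₀ hx0 hx1 hlt.2.1
    have hc : 0 < x ^ c := by positivity
    linarith
  · rw [max_eq_left h.le]
    exact le_max_of_pow_add_pow_eq_one_of_lt hx0 hx1 he h hx hx'

theorem mainTheorem5 (n : ℕ) (lam : ℝ) (hlam0 : 0 < lam) (hlam1 : lam < 1)
    (a b c d e : ℕ) (ha : 0 < a) (hb : 0 < b) (hc : 0 < c) (hd : 0 < d) (he : 0 < e)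
    (hα : IsContractionVector n ![lam ^ a, lam ^ b, lam ^ c])
    (hβ : IsContractionVector n ![lam ^ d, lam ^ e])
    (h : DustLipschitzEquivalent n ![lam ^ a, lam ^ b, lam ^ c] ![lam ^ d, lam ^ e]) :
    max d e ≤ max a (max b c) := by
  have hα' : ![lam ^ a, lam ^ b, lam ^ c] = fun i => lam ^ (![a, b, c] i) := by
    ext i; fin_cases i <;> rfl
  have hβ' : ![lam ^ d, lam ^ e] = fun i => lam ^ (![d, e] i) := by
    ext i; fin_cases i <;> rfl
  rw [hα', hβ'] at h
  have hp : ∀ i, 0 < ![a, b, c] i := by intro i; fin_cases i <;> assumption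
  have hq : ∀ i, 0 < ![d, e] i := by intro i; fin_cases i <;> assumption
  obtain ⟨x, hx0, hx1, hx, hx'⟩ :=
    h.exists_common_root (by norm_num) le_rfl hlam0 hlam1 hp hq
  refine max_le_max_of_pow_add_pow_eq_one hx0 hx1 hd he ?_ ?_
  · simpa [Fin.sum_univ_two] using hx'
  · simpa [Fin.sum_univ_three] using hx
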